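/- Let $\Xi$ be a countable set, $\widetilde\pi$ a probability distribution on $\Xi$ and $\widetilde Q$ a Markov transition kernel on $\Xi$ such that (i) $\widetilde\pi(\xi)>0$ for all $\xi$; (ii) $\widetilde Q(\xi,\xi')\neq 0 \iff \widetilde Q(\xi',\xi)\neq 0$; (iii) $\widetilde Q$ is irreducible. Let $\mathcal E=\{(\xi,\xi'):\widetilde Q(\xi,\xi')>0\}$. Let $\mathcal G_i^+=(\mathcal V_i,\mathcal E_i^+)$, $i=1,\dots,n$, be directed graphs with $\mathcal V_i\subseteq\Xi$, with nonempty edge sets and no isolated vertices, and put $\mathcal E_i^-=\{(u,v):(v,u)\in\mathcal E_i^+\}$. Assume that $\mathcal E_i^+\cap\mathcal E_i^-=\emptyset$, that $\bigcup_i\mathcal V_i=\Xi$ and $\bigcup_i(\mathcal E_i^+\cup\mathcal E_i^-)=\mathcal E$. Put $\mathcal N_i^{\pm1}(\xi)=\{\xi':(\xi,\xi')\in\mathcal E_i^{\pm}\}$ and $\widetilde\omega_i(\xi)=\widetilde Q(\xi,\mathcal N_i^{+1}(\xi))+\widetilde Q(\xi,\mathcal N_i^{-1}(\xi))$, and assume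 $\sum_{i=1}^n\widetilde\omega_i(\xi)=1$ for every $\xi$. Call $i$ active in $\xi$ if $\widetilde\omega_i(\xi)>0$. Let $\mathcal X=\Xi\times\{-1,1\}^n$, let $R_i\theta$ be $\theta$ with the sign of its $i$th component flipped, $S_i(\xi,\theta)=(\xi,R_i\theta)$, and $\pi(\xi,\theta)=2^{-n}\widetilde\pi(\xi)$. For $x=(\xi,\theta)$ with $i$ active in $\xi$ let $Q_i(x,\cdot)$ be the distribution with $$Q_i\big((\xi,\theta),(\xi',\theta)\big)=\frac{\widetilde Q(\xi,\xi')}{\widetilde Q(\xi,\mathcal N_i^{\theta_i}(\xi))}\quad\text{for }\xi'\in\mathcal N_i^{\theta_i}(\xi)$$ if $\mathcal N_i^{\theta_i}(\xi)\ne\emptyset$, and the point mass at $S_i(x)$ if $\mathcal N_i^{\theta_i}(\xi)=\emptyset$. Let $P_i$ be the kernel that from $x=(\xi,\theta)$ draws $x'=(\xi',\theta')\sim Q_i(x,\cdot)$, moves to $x'$ with probability $\min(1,r_i(x,x'))$, where $$r_i(x,x')=\frac{\widetilde\omega_i(\xi')\,\widetilde\pi(\xi')\,Q_i(S_i(x'),S_i(x))}{\widetilde\omega_i(\xi)\,\widetilde\pi(\xi)\,Q_i(x,x')},$$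 and moves to $S_i(x)$ otherwise. Let $\mathcal P((\xi,\theta),\cdot)=\sum_{i=1}^n\widetilde\omega_i(\xi)P_i((\xi,\theta),\cdot)$. Assume that for every $(\xi,\theta)\in\mathcal X$ and every $i$ active in $\xi$ there are $m\in\mathbb N$ and $\xi'\in\Xi$ with $P_i^m\big((\xi,\theta),(\xi',R_i\theta)\big)>0$. Then $\mathcal P$ is irreducible: for all $x,x'\in\mathcal X$ there is $m\in\mathbb N$ with $\mathcal P^m(x,x')>0$. Moreover, for every Markov chain $(x_k)_{k\in\mathbb N}$ with transition kernel $\mathcal P$, started at an arbitrary state $\tilde x_0\in\mathcal X$: (a) for every $x'\in\mathcal X$, almost surely $\displaystyle\lim_{N\to\infty}\frac1N\sum_{k=0}^{N-1}\mathbf 1_{\{x'\}}(x_k)=\pi(x')$; (b) for every $\varphi:\mathcal X\to\mathbb R$ with $\sum_{x\in\mathcal X}|\varphi(x)|\,\pi(x)<\infty$, almost surely $\displaystyle\lim_{N\to\infty}\frac1N\sum_{k=0}^{N-1}\varphi(x_k)=\sum_{x\in\mathcal X}\varphi(x)\pi(x)$. -/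

import Mathlib

open scoped ENNReal

noncomputable section

namespace LiftedFlow

/-! ### Markov chains on a discrete space -/

/-- The `m`-step transition kernel `K^m` of a Markov kernel `K` on a discrete space. -/
def kernelPow {S : Type*} (K : S → PMF S) : ℕ → S → PMF S
  | 0, x => PMF.pure x
  | m + 1, x => (kernelPow K m x).bind K

/-- Irreducibility: every state is reached from every state in finitely many steps
with positive probability. -/
def IsIrreducible {S : Type*} (K : S → PMF S) : Prop :=
  ∀ x x' : S, ∃ m : ℕ, 0 < kernelPow K m x x'

/-- `X` is (a realisation on the probability space `(Ω, μ)` of) the Markov chain with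
transition kernel `K` and deterministic initial state `x₀`. -/
structure IsMarkovChain {S Ω : Type*} [MeasurableSpace Ω] (μ : MeasureTheory.Measure Ω)
    (K : S → PMF S) (x₀ : S) (X : ℕ → Ω → S) : Prop where
  measurable : ∀ (k : ℕ) (x : S), MeasurableSet {ω | X k ω = x}
  initial : ∀ᵐ ω ∂μ, X 0 ω = x₀
  markov : ∀ (N : ℕ) (a : ℕ → S),
    μ {ω | ∀ k ≤ N + 1, X k ω = a k} = μ {ω | ∀ k ≤ N, X k ω = a k} * K (a N) (a (N + 1))

/-! ### Flows on the state graph of a proposal kernel -/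

/-- The reversed edge set `E⁻ = {(u, v) | (v, u) ∈ E⁺}`. -/
def reverseEdges {Ξ : Type*} (E : Set (Ξ × Ξ)) : Set (Ξ × Ξ) := {e | (e.2, e.1) ∈ E}

/-- The neighbourhood `{ξ' | (ξ, ξ') ∈ E}`. -/
def outNbhd {Ξ : Type*} (E : Set (Ξ × Ξ)) (ξ : Ξ) : Set Ξ := {ξ' | (ξ, ξ') ∈ E}

/-- A collection of `n` flows on the state graph of the proposal kernel `Q`: oriented subgraphs
`(V i, E i)` (here `E i` is the positive edge set `E_i⁺`) with nonempty edge sets and without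
isolated vertices, whose symmetric completions cover the state graph, and such that the weights
`ω_i(ξ) = Q(ξ, N_i⁺(ξ)) + Q(ξ, N_i⁻(ξ))` form a point of the standard simplex at each state. -/
structure Flows {Ξ : Type*} (Q : Ξ → PMF Ξ) (n : ℕ) where
  V : Fin n → Set Ξ
  E : Fin n → Set (Ξ × Ξ)
  edge_mem : ∀ i, ∀ e ∈ E i, e.1 ∈ V i ∧ e.2 ∈ V i
  edge_nonempty : ∀ i, (E i).Nonempty
  no_isolated : ∀ i, ∀ ξ ∈ V i, ∃ ξ', (ξ, ξ') ∈ E i ∪ reverseEdges (E i)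
  oriented : ∀ i, Disjoint (E i) (reverseEdges (E i))
  cover_vertices : ⋃ i, V i = Set.univ
  cover_edges : ⋃ i, (E i ∪ reverseEdges (E i)) = {e : Ξ × Ξ | 0 < Q e.1 e.2}
  weight_sum : ∀ ξ, ∑ i, ((Q ξ).toOuterMeasure (outNbhd (E i) ξ)
    + (Q ξ).toOuterMeasure (outNbhd (reverseEdges (E i)) ξ)) = 1

/-- The extended state space `Ξ × {-1, 1}ⁿ`. -/
abbrev ExtState (Ξ : Type*) (n : ℕ) : Type _ := Ξ × (Fin n → ℤˣ)

/-- `R_i` flips the sign of the `i`-th momentum component. -/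
def flipMomentum {n : ℕ} (i : Fin n) (θ : Fin n → ℤˣ) : Fin n → ℤˣ := Function.update θ i (-θ i)

/-- The involution `S_i (ξ, θ) = (ξ, R_i θ)`. -/
def involution {Ξ : Type*} {n : ℕ} (i : Fin n) (x : ExtState Ξ n) : ExtState Ξ n :=
  (x.1, flipMomentum i x.2)

/-- The extended target `π(ξ, θ) = 2⁻ⁿ π̃(ξ)`. -/
def extTarget {Ξ : Type*} {n : ℕ} (p : PMF Ξ) (x : ExtState Ξ n) : ℝ :=
  (1 / 2 ^ n) * (p x.1).toReal

/-- The Bernoulli distribution with success probability `min 1 r`; it is the law of the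
indicator of `u < r` for `u` uniform on `[0, 1]`. -/
def coin (r : ℝ≥0∞) : PMF Bool :=
  PMF.ofFintype (fun b => cond b (min 1 r) (1 - min 1 r)) (by simp)

namespace Flows

variable {Ξ : Type*} {Q : Ξ → PMF Ξ} {n : ℕ} (F : Flows Q n)

/-- The neighbourhood `N_i^s(ξ)` in direction `s ∈ {-1, 1}`. -/
def nbhd (i : Fin n) (s : ℤˣ) (ξ : Ξ) : Set Ξ :=
  if s = 1 then outNbhd (F.E i) ξ else outNbhd (reverseEdges (F.E i)) ξ

/-- The generic weights `ω_i(ξ) = Q(ξ, N_i⁺(ξ)) + Q(ξ, N_i⁻(ξ))`. -/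
def weight (ξ : Ξ) (i : Fin n) : ℝ≥0∞ :=
  (Q ξ).toOuterMeasure (F.nbhd i 1 ξ) + (Q ξ).toOuterMeasure (F.nbhd i (-1) ξ)

theorem sum_weight (ξ : Ξ) : ∑ i, F.weight ξ i = 1 := by
  have h : (-1 : ℤˣ) ≠ 1 := by decide
  simpa [weight, nbhd, h] using F.weight_sum ξ

theorem exists_mem_support {i : Fin n} {s : ℤˣ} {ξ : Ξ} (h : (F.nbhd i s ξ).Nonempty) :
    ∃ ξ' ∈ F.nbhd i s ξ, ξ' ∈ (Q ξ).support := by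
  obtain ⟨ξ', hξ'⟩ := h
  refine ⟨ξ', hξ', ?_⟩
  have h1 : (ξ, ξ') ∈ F.E i ∪ reverseEdges (F.E i) := by
    unfold nbhd at hξ'
    split_ifs at hξ'
    · exact Or.inl hξ'
    · exact Or.inr hξ'
  have h2 : (ξ, ξ') ∈ {e : Ξ × Ξ | 0 < Q e.1 e.2} := by
    rw [← F.cover_edges]
    exact Set.mem_iUnion.2 ⟨i, h1⟩
  exact (PMF.mem_support_iff _ _).2 (ne_of_gt h2)

/-- The index `i` is active in `ξ`. -/
def Active (ξ : Ξ) (i : Fin n) : Prop := 0 < F.weight ξ i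

open Classical in
/-- The proposal kernel `Q_i`: from `(ξ, θ)` it draws `ξ'` from `Q(ξ, ·)` conditioned on
`N_i^{θ_i}(ξ)` and keeps `θ`; if this neighbourhood is empty, it proposes `(ξ, R_i θ)`.
(Only its values at states in which `i` is active matter.) -/
def proposal (i : Fin n) (x : ExtState Ξ n) : PMF (ExtState Ξ n) :=
  if h : (F.nbhd i (x.2 i) x.1).Nonempty then
    ((Q x.1).filter (F.nbhd i (x.2 i) x.1) (F.exists_mem_support h)).map (fun ξ' => (ξ', x.2))
  else PMF.pure (involution i x)

/-- The Metropolis-Hastings ratio `r_i(x, x')`. -/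
def ratio (p : PMF Ξ) (i : Fin n) (x x' : ExtState Ξ n) : ℝ≥0∞ :=
  (F.weight x'.1 i * p x'.1 * F.proposal i (involution i x') (involution i x))
    / (F.weight x.1 i * p x.1 * F.proposal i x x')

/-- The kernel `P_i`: propose `x'` from `Q_i(x, ·)`, accept it with probability
`min(1, r_i(x, x'))`, and move to `S_i(x)` otherwise. -/
def stepKernel (p : PMF Ξ) (i : Fin n) (x : ExtState Ξ n) : PMF (ExtState Ξ n) :=
  (F.proposal i x).bind fun x' =>
    (coin (F.ratio p i x x')).map fun b => if b then x' else involution i x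

/-- The transition kernel `∑ i, ω_i(ξ) P_i((ξ, θ), ·)` of the lifted chain: draw `i` from
`ω(ξ)`, then move according to `P_i`. -/
def chainKernel (p : PMF Ξ) (x : ExtState Ξ n) : PMF (ExtState Ξ n) :=
  (PMF.ofFintype (F.weight x.1) (F.sum_weight x.1)).bind fun i => F.stepKernel p i x

/-- Every active momentum component can eventually be flipped by its own kernel `P_i`. -/
def Flippable (p : PMF Ξ) : Prop :=
  ∀ (ξ : Ξ) (θ : Fin n → ℤˣ) (i : Fin n), F.Active ξ i →
    ∃ (m : ℕ) (ξ' : Ξ), 0 < kernelPow (F.stepKernel p i) m (ξ, θ) (ξ', flipMomentum i θ)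

end Flows

/-- The assumptions on target and proposal: positivity, symmetric support, irreducibility. -/
structure Admissible {Ξ : Type*} (Q : Ξ → PMF Ξ) (p : PMF Ξ) : Prop where
  pos : ∀ ξ, 0 < p ξ
  symm : ∀ ξ ξ', Q ξ ξ' ≠ 0 ↔ Q ξ' ξ ≠ 0
  irreducible : IsIrreducible Q

end LiftedFlow

end

/-!
Under skew detailed balance, the flow of mass from `x` to `y` through `P_i`, weighted by `ω_i π`,
equals the flow from `S_i y` to `S_i x`. Summing over `x` and `i` shows that `π` is invariant.

For irreducibility, follow a path of `P_i` from `(ξ, θ)` until the momentum `θ_i` is first flipped.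
By skew detailed balance the part of the path before the flip can be retraced with reversed
momentum, which ends at `(ξ, R_i θ)`. Momenta can thus be flipped in place, so every edge of `Q̃`
can be followed from either momentum, and the irreducibility of `Q̃` gives that of the lifted chain.

The strong law holds for every irreducible kernel with an invariant distribution. The law of the
stationary chain on path space is preserved by the shift, and for a shift-invariant event `A` the
probability of `A` given the initial state is a harmonic function, hence constant. By the Markov
property `A` is then independent of every cylinder, hence of itself, so the shift is ergodic and
Birkhoff's theorem applies. As the invariant distribution charges every state, almost sure
statements about the stationary chain hold from any initial state.
-/

open MeasureTheory ProbabilityTheory Filter Topology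

namespace LiftedFlow

section Birkhoff

variable {α : Type*}

/-- The running maximum `max_{k ≤ n} S_k f` of the Birkhoff sums `S_k f` of `f` along `T`, in the
recursive form `M_{n+1} = max 0 (f + M_n ∘ T)` on which the maximal ergodic inequality rests. -/
def birkhoffMax (T : α → α) (f : α → ℝ) : ℕ → α → ℝ
  | 0, _ => 0
  | n + 1, x => max 0 (f x + birkhoffMax T f n (T x))

/-- The points at which the Birkhoff sums of `f` are unbounded above. -/
def birkhoffDivergence (T : α → α) (f : α → ℝ) : Set α :=
  {x | ¬ BddAbove (Set.range fun n => birkhoffSum T f n x)}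

theorem birkhoffMax_nonneg (T : α → α) (f : α → ℝ) (n : ℕ) (x : α) : 0 ≤ birkhoffMax T f n x := by
  cases n with
  | zero => exact le_rfl
  | succ n => exact le_max_left _ _

theorem birkhoffMax_le_succ (T : α → α) (f : α → ℝ) (n : ℕ) (x : α) :
    birkhoffMax T f n x ≤ birkhoffMax T f (n + 1) x := by
  induction n generalizing x with
  | zero => exact birkhoffMax_nonneg T f 1 x
  | succ n ih => exact max_le_max le_rfl (add_le_add_right (ih (T x)) _)

theorem monotone_birkhoffMax (T : α → α) (f : α → ℝ) (x : α) :
    Monotone fun n => birkhoffMax T f n x :=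
  monotone_nat_of_le_succ fun n => birkhoffMax_le_succ T f n x

theorem birkhoffSum_le_birkhoffMax (T : α → α) (f : α → ℝ) (n : ℕ) (x : α) :
    birkhoffSum T f n x ≤ birkhoffMax T f n x := by
  induction n generalizing x with
  | zero => exact (birkhoffSum_zero T f x).le
  | succ n ih =>
    rw [birkhoffSum_succ']
    exact (add_le_add_right (ih (T x)) _).trans (le_max_right _ _)

theorem abs_birkhoffMax_succ_sub_le (T : α → α) (f : α → ℝ) (n : ℕ) (x : α) :
    |birkhoffMax T f (n + 1) x - birkhoffMax T f n (T x)| ≤ |f x| := by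
  have hM := birkhoffMax_nonneg T f n (T x)
  calc |birkhoffMax T f (n + 1) x - birkhoffMax T f n (T x)|
      = |max 0 (f x + birkhoffMax T f n (T x)) - max 0 (birkhoffMax T f n (T x))| := by
        rw [max_eq_right hM, birkhoffMax]
    _ ≤ |f x| := by
        rw [max_comm 0, max_comm 0]
        exact (abs_max_sub_max_le_abs _ _ 0).trans_eq (by rw [add_sub_cancel_right])

theorem preimage_birkhoffDivergence (T : α → α) (f : α → ℝ) :
    T ⁻¹' birkhoffDivergence T f = birkhoffDivergence T f := by
  ext x
  refine not_congr ⟨?_, ?_⟩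
  · rintro ⟨C, hC⟩
    refine ⟨max 0 (f x + C), Set.forall_mem_range.2 fun n => ?_⟩
    cases n with
    | zero => simp
    | succ n =>
      rw [birkhoffSum_succ']
      exact (add_le_add_right (hC ⟨n, rfl⟩) _).trans (le_max_right _ _)
  · rintro ⟨C, hC⟩
    refine ⟨C - f x, Set.forall_mem_range.2 fun n => ?_⟩
    rw [le_sub_iff_add_le', ← birkhoffSum_succ']
    exact hC ⟨n + 1, rfl⟩

theorem eventually_birkhoffMax_succ_sub_eq {T : α → α} {f : α → ℝ} {x : α}
    (hx : x ∈ birkhoffDivergence T f) :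
    ∀ᶠ n in atTop, birkhoffMax T f (n + 1) x - birkhoffMax T f n (T x) = f x := by
  rw [← preimage_birkhoffDivergence] at hx
  obtain ⟨_, ⟨n, rfl⟩, hn⟩ := not_bddAbove_iff.1 hx (-f x)
  filter_upwards [eventually_ge_atTop n] with m hm
  have hM : -f x < birkhoffMax T f m (T x) :=
    (hn.trans_le (birkhoffSum_le_birkhoffMax T f n (T x))).trans_le
      (monotone_birkhoffMax T f (T x) hm)
  rw [birkhoffMax, max_eq_right (by linarith), add_sub_cancel_right]

variable [MeasurableSpace α] {T : α → α} {f : α → ℝ} {ν : Measure α}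

theorem measurable_birkhoffSum (hT : Measurable T) (hf : Measurable f) (n : ℕ) :
    Measurable (birkhoffSum T f n) :=
  Finset.measurable_fun_sum _ fun k _ => hf.comp (hT.iterate k)

theorem integrable_birkhoffMax (hT : MeasurePreserving T ν ν) (hf : Integrable f ν) (n : ℕ) :
    Integrable (birkhoffMax T f n) ν := by
  induction n with
  | zero => exact integrable_zero _ _ _
  | succ n ih => exact (integrable_zero _ _ _).sup (hf.add (hT.integrable_comp_of_integrable ih))

theorem measurableSet_birkhoffDivergence (hT : Measurable T) (hf : Measurable f) :
    MeasurableSet (birkhoffDivergence T f) :=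
  (measurableSet_bddAbove_range (measurable_birkhoffSum hT hf)).compl

theorem setIntegral_birkhoffMax_succ_sub_nonneg (hT : MeasurePreserving T ν ν)
    (hf : Integrable f ν) {A : Set α} (hA : MeasurableSet A) (hTA : T ⁻¹' A = A) (n : ℕ) :
    0 ≤ ∫ x in A, (birkhoffMax T f (n + 1) x - birkhoffMax T f n (T x)) ∂ν := by
  have hM := integrable_birkhoffMax hT hf
  have hMT : Integrable (fun x => birkhoffMax T f n (T x)) ν :=
    hT.integrable_comp_of_integrable (hM n)
  have hTν : MeasurePreserving T (ν.restrict A) (ν.restrict A) := by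
    simpa only [hTA] using hT.restrict_preimage hA
  have hshift : ∫ x in A, birkhoffMax T f n (T x) ∂ν = ∫ x in A, birkhoffMax T f n x ∂ν := by
    conv_rhs => rw [← hTν.map_eq]
    refine (integral_map hTν.aemeasurable ?_).symm
    rw [hTν.map_eq]
    exact (hM n).aestronglyMeasurable.restrict
  rw [integral_sub (hM _).integrableOn hMT.integrableOn, hshift, sub_nonneg]
  exact setIntegral_mono (hM _).integrableOn (hM _).integrableOn (birkhoffMax_le_succ T f n)

theorem setIntegral_birkhoffDivergence_nonneg (hT : MeasurePreserving T ν ν)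
    (hfm : Measurable f) (hf : Integrable f ν) :
    0 ≤ ∫ x in birkhoffDivergence T f, f x ∂ν := by
  have hA := measurableSet_birkhoffDivergence hT.measurable hfm
  have hM := integrable_birkhoffMax hT hf
  have hlim : Tendsto (fun n => ∫ x in birkhoffDivergence T f,
      (birkhoffMax T f (n + 1) x - birkhoffMax T f n (T x)) ∂ν)
      atTop (𝓝 (∫ x in birkhoffDivergence T f, f x ∂ν)) := by
    refine tendsto_integral_of_dominated_convergence (fun x => |f x|) (fun n => ?_)
      hf.abs.integrableOn (fun n => .of_forall (abs_birkhoffMax_succ_sub_le T f n)) ?_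
    · exact ((hM (n + 1)).sub
        (hT.integrable_comp_of_integrable (hM n))).aestronglyMeasurable.restrict
    · exact (ae_restrict_iff' hA).2 <| .of_forall fun x hx =>
        tendsto_const_nhds.congr' ((eventually_birkhoffMax_succ_sub_eq hx).mono fun _ h => h.symm)
  exact ge_of_tendsto' hlim
    (setIntegral_birkhoffMax_succ_sub_nonneg hT hf hA (preimage_birkhoffDivergence T f))

theorem ae_bddAbove_birkhoffSum (hT : Ergodic T ν) (hfm : Measurable f) (hf : Integrable f ν)
    (hneg : ∫ x, f x ∂ν < 0) :
    ∀ᵐ x ∂ν, BddAbove (Set.range fun n => birkhoffSum T f n x) := by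
  have hA := measurableSet_birkhoffDivergence hT.measurable hfm
  rcases hT.ae_empty_or_univ hA (preimage_birkhoffDivergence T f) with h | h
  · filter_upwards [measure_eq_zero_iff_ae_notMem.1 (ae_eq_empty.1 h)] with x hx
    exact not_not.1 hx
  · have hnonneg := setIntegral_birkhoffDivergence_nonneg hT.toMeasurePreserving hfm hf
    rw [setIntegral_congr_set h, setIntegral_univ] at hnonneg
    exact absurd hneg hnonneg.not_gt

theorem ae_eventually_birkhoffAverage_lt [IsProbabilityMeasure ν] (hT : Ergodic T ν)
    (hfm : Measurable f) (hf : Integrable f ν) {c : ℝ} (hc : ∫ x, f x ∂ν < c) :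
    ∀ᵐ x ∂ν, ∀ᶠ n in atTop, birkhoffAverage ℝ T f n x < c := by
  obtain ⟨b, hb, hbc⟩ := exists_between hc
  have hneg : ∫ x, (f - fun _ => b : α → ℝ) x ∂ν < 0 := by
    rw [integral_sub' hf (integrable_const b), integral_const, probReal_univ, one_smul]
    exact sub_neg.2 hb
  filter_upwards [ae_bddAbove_birkhoffSum hT (hfm.sub measurable_const)
    (hf.sub (integrable_const b)) hneg] with x ⟨C, hC⟩
  have hlim : Tendsto (fun n : ℕ => (n : ℝ)⁻¹ * C + b) atTop (𝓝 b) := by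
    simpa using (tendsto_inv_atTop_nhds_zero_nat.mul_const C).add_const b
  filter_upwards [hlim.eventually_lt_const hbc, eventually_ne_atTop 0] with n hn hn0
  have hconst : birkhoffAverage ℝ T (fun _ => b) n = fun _ => b :=
    birkhoffAverage_of_comp_eq ℝ rfl (Nat.cast_ne_zero.2 hn0)
  have havg : birkhoffAverage ℝ T (f - fun _ => b) n x ≤ (n : ℝ)⁻¹ * C :=
    mul_le_mul_of_nonneg_left (hC ⟨n, rfl⟩) (by positivity)
  rw [birkhoffAverage_sub, Pi.sub_apply, hconst, Pi.sub_apply] at havg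
  linarith

theorem ae_tendsto_birkhoffAverage_of_measurable [IsProbabilityMeasure ν] (hT : Ergodic T ν)
    (hfm : Measurable f) (hf : Integrable f ν) :
    ∀ᵐ x ∂ν, Tendsto (fun n => birkhoffAverage ℝ T f n x) atTop (𝓝 (∫ y, f y ∂ν)) := by
  have hupper : ∀ᵐ x ∂ν, ∀ q : ℚ, ∫ y, f y ∂ν < q →
      ∀ᶠ n in atTop, birkhoffAverage ℝ T f n x < q :=
    ae_all_iff.2 fun q => eventually_imp_distrib_left.2 fun hq =>
      ae_eventually_birkhoffAverage_lt hT hfm hf hq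
  have hlower : ∀ᵐ x ∂ν, ∀ q : ℚ, q < ∫ y, f y ∂ν →
      ∀ᶠ n in atTop, q < birkhoffAverage ℝ T f n x := by
    refine ae_all_iff.2 fun q => eventually_imp_distrib_left.2 fun hq => ?_
    have hq' : ∫ y, (-f) y ∂ν < -q := by simpa [integral_neg] using hq
    simpa [birkhoffAverage_neg] using ae_eventually_birkhoffAverage_lt hT hfm.neg hf.neg hq'
  filter_upwards [hupper, hlower] with x hux hlx
  refine tendsto_order.2 ⟨fun a ha => ?_, fun a ha => ?_⟩
  · obtain ⟨q, haq, hq⟩ := exists_rat_btwn ha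
    exact (hlx q hq).mono fun _ => haq.trans
  · obtain ⟨q, hq, hqa⟩ := exists_rat_btwn ha
    exact (hux q hq).mono fun _ h => h.trans hqa

theorem ae_tendsto_birkhoffAverage [IsProbabilityMeasure ν] (hT : Ergodic T ν)
    (hf : Integrable f ν) :
    ∀ᵐ x ∂ν, Tendsto (fun n => birkhoffAverage ℝ T f n x) atTop (𝓝 (∫ y, f y ∂ν)) := by
  obtain ⟨g, hg, hfg⟩ := hf.aestronglyMeasurable.aemeasurable
  have havg : ∀ᵐ x ∂ν, ∀ n, birkhoffAverage ℝ T f n x = birkhoffAverage ℝ T g n x :=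
    ae_all_iff.2 (hT.quasiMeasurePreserving.birkhoffAverage_ae_eq_of_ae_eq ℝ hfg)
  rw [integral_congr_ae hfg]
  filter_upwards [havg, ae_tendsto_birkhoffAverage_of_measurable hT hg (hf.congr hfg)]
    with x hx hlim
  simpa only [hx] using hlim

end Birkhoff

section Accessible

variable {S : Type*} {K : S → PMF S} {p : PMF S}

/-- The chain with transition kernel `K` can move from `x` to `y` in finitely many steps. -/
def Accessible (K : S → PMF S) : S → S → Prop :=
  Relation.ReflTransGen fun x y => 0 < K x y

theorem bind_apply_pos_iff {q : PMF S} {y : S} :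
    0 < q.bind K y ↔ ∃ x, 0 < q x ∧ 0 < K x y := by
  simp_rw [PMF.apply_pos_iff, PMF.mem_support_bind_iff]

theorem accessible_iff {x y : S} : Accessible K x y ↔ ∃ m, 0 < kernelPow K m x y := by
  constructor
  · intro h
    induction h with
    | refl => exact ⟨0, by simp [kernelPow]⟩
    | tail _ hyz ih =>
      obtain ⟨m, hm⟩ := ih
      exact ⟨m + 1, bind_apply_pos_iff.2 ⟨_, hm, hyz⟩⟩
  · rintro ⟨m, hm⟩
    induction m generalizing y with
    | zero =>
      obtain rfl : y = x := by
        rwa [kernelPow, PMF.apply_pos_iff, PMF.mem_support_pure_iff] at hm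
      exact .refl
    | succ m ih =>
      obtain ⟨z, hxz, hzy⟩ := bind_apply_pos_iff.1 hm
      exact (ih hxz).tail hzy

theorem IsIrreducible.accessible (hirr : IsIrreducible K) (x y : S) : Accessible K x y :=
  accessible_iff.2 (hirr x y)

theorem Accessible.apply_pos (hp : p.bind K = p) {s t : S} (hst : Accessible K s t)
    (hs : 0 < p s) : 0 < p t := by
  induction hst with
  | refl => exact hs
  | tail _ hstep ih =>
    rw [← hp]
    exact bind_apply_pos_iff.2 ⟨_, ih, hstep⟩

theorem IsIrreducible.apply_pos (hirr : IsIrreducible K) (hp : p.bind K = p) (s : S) :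
    0 < p s := by
  obtain ⟨s₀, hs₀⟩ := p.support_nonempty
  exact (hirr.accessible s₀ s).apply_pos hp ((p.apply_pos_iff s₀).2 hs₀)

theorem IsIrreducible.countable (hirr : IsIrreducible K) (hp : p.bind K = p) : Countable S := by
  have hsupp : p.support = Set.univ :=
    Set.eq_univ_of_forall fun s => (p.apply_pos_iff s).1 (hirr.apply_pos hp s)
  exact Set.countable_univ_iff.1 (hsupp ▸ p.support_countable)

end Accessible

section Superharmonic

variable {S : Type*} {K : S → PMF S} {p : PMF S} {h : S → ℝ≥0∞}

/-- Superharmonic functions of a transition kernel. -/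
def IsSuperharmonic (K : S → PMF S) (h : S → ℝ≥0∞) : Prop := ∀ s, ∑' t, K s t * h t ≤ h s

theorem tsum_pmf_mul_const (q : PMF S) (c : ℝ≥0∞) : ∑' t, q t * c = c := by
  rw [ENNReal.tsum_mul_right, q.tsum_coe, one_mul]

theorem eq_of_le_of_tsum_pmf_mul_eq {q : PMF S} {f g : S → ℝ≥0∞} (hle : f ≤ g)
    (hfin : ∑' s, q s * g s ≠ ∞) (heq : ∑' s, q s * f s = ∑' s, q s * g s) {s : S}
    (hs : 0 < q s) : f s = g s := by
  by_contra hne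
  have hlt : q s * f s < q s * g s :=
    (ENNReal.mul_lt_mul_iff_right hs.ne' (q.apply_ne_top s)).2 ((hle s).lt_of_ne hne)
  exact heq.not_lt (ENNReal.tsum_lt_tsum (heq ▸ hfin) (fun t => mul_le_mul_right (hle t) _) hlt)

theorem tsum_bind_mul (q : PMF S) (K : S → PMF S) (h : S → ℝ≥0∞) :
    ∑' t, q.bind K t * h t = ∑' s, q s * ∑' t, K s t * h t := by
  simp_rw [PMF.bind_apply, ← ENNReal.tsum_mul_right, ← ENNReal.tsum_mul_left, mul_assoc]
  exact ENNReal.tsum_comm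

theorem IsSuperharmonic.min_const (hh : IsSuperharmonic K h) (c : ℝ≥0∞) :
    IsSuperharmonic K fun s => min (h s) c := fun s =>
  le_min ((ENNReal.tsum_le_tsum fun _ => mul_le_mul_right (min_le_left _ _) _).trans (hh s))
    ((ENNReal.tsum_le_tsum fun _ => mul_le_mul_right (min_le_right _ _) _).trans
      (tsum_pmf_mul_const (K s) c).le)

/-- Truncating `h` at the level `c` gives a superharmonic function of finite mean, which an
invariant distribution forces to be harmonic; where it attains its maximum `c`, it is `c` at all
successors. -/
theorem IsSuperharmonic.le_of_le (hh : IsSuperharmonic K h) (hp : p.bind K = p) {c : ℝ≥0∞}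
    (hc : c ≠ ∞) {s t : S} (hs : 0 < p s) (hst : 0 < K s t) (hcs : c ≤ h s) : c ≤ h t := by
  let g : S → ℝ≥0∞ := fun u => min (h u) c
  have hgc : ∀ q : PMF S, ∑' u, q u * g u ≤ c := fun q =>
    (ENNReal.tsum_le_tsum fun _ => mul_le_mul_right (min_le_right _ _) _).trans
      (tsum_pmf_mul_const q c).le
  have hharm : ∑' u, K s u * g u = g s :=
    eq_of_le_of_tsum_pmf_mul_eq (hh.min_const c) (ne_top_of_le_ne_top hc (hgc p))
      (by rw [← tsum_bind_mul, hp]) hs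
  have hmax : g t = c := by
    refine eq_of_le_of_tsum_pmf_mul_eq (q := K s) (g := fun _ => c) (fun u => min_le_right _ _)
      (by rwa [tsum_pmf_mul_const]) ?_ hst
    rw [tsum_pmf_mul_const, hharm]
    exact min_eq_right hcs
  exact min_eq_right_iff.1 hmax

theorem IsSuperharmonic.eq (hh : IsSuperharmonic K h) (hp : p.bind K = p)
    (hirr : IsIrreducible K) (s t : S) : h s = h t := by
  have hle : ∀ u v, h u ≤ h v := fun u v => ENNReal.le_of_forall_nnreal_lt fun c hc => by
    induction hirr.accessible u v with
    | refl => exact hc.le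
    | tail _ hstep ih =>
      exact hh.le_of_le hp ENNReal.coe_ne_top (hirr.apply_pos hp _) hstep ih
  exact (hle s t).antisymm (hle t s)

end Superharmonic

section PathSpace

variable {S : Type*}

/-- The set of paths that agree with `a` up to time `N`. -/
def pathCylinder (N : ℕ) (a : ℕ → S) : Set (ℕ → S) := {x | ∀ k ≤ N, x k = a k}

/-- The set of paths that start in `s`. -/
def startsAt (s : S) : Set (ℕ → S) := {x | x 0 = s}

/-- The time shift of paths. -/
def pathShift (x : ℕ → S) : ℕ → S := fun k => x (k + 1)

/-- The path that starts in `s` and continues as `a`. -/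
def pathCons (s : S) (a : ℕ → S) : ℕ → S
  | 0 => s
  | k + 1 => a k

theorem pathCons_pathShift (a : ℕ → S) : pathCons (a 0) (pathShift a) = a := by
  funext k
  cases k <;> rfl

theorem pathShift_iterate_apply_zero (k : ℕ) (x : ℕ → S) : (pathShift^[k] x) 0 = x k := by
  induction k generalizing x with
  | zero => rfl
  | succ _ ih => exact ih (pathShift x)

theorem pathCylinder_zero (a : ℕ → S) : pathCylinder 0 a = startsAt (a 0) := by
  simp [pathCylinder, startsAt]

theorem startsAt_inter_preimage_pathShift (s : S) (N : ℕ) (a : ℕ → S) :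
    startsAt s ∩ pathShift ⁻¹' pathCylinder N a = pathCylinder (N + 1) (pathCons s a) := by
  ext x
  constructor
  · rintro ⟨h0, h⟩ (_ | k) hk
    · exact h0
    · exact h k (by lia)
  · exact fun h => ⟨h 0 (by lia), fun k hk => h (k + 1) (by lia)⟩

theorem pathCylinder_succ (N : ℕ) (a : ℕ → S) :
    pathCylinder (N + 1) a = startsAt (a 0) ∩ pathShift ⁻¹' pathCylinder N (pathShift a) := by
  rw [startsAt_inter_preimage_pathShift, pathCons_pathShift]

theorem pathCylinder_succ_inter_preimage_iterate (N : ℕ) (a : ℕ → S) (B : Set (ℕ → S)) :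
    pathCylinder (N + 1) a ∩ pathShift^[N + 1] ⁻¹' B
      = startsAt (a 0) ∩ pathShift ⁻¹' (pathCylinder N (pathShift a) ∩ pathShift^[N] ⁻¹' B) := by
  rw [pathCylinder_succ, Set.inter_assoc, Set.preimage_inter, ← Set.preimage_comp,
    ← Function.iterate_succ]

theorem preimage_frestrictLe_singleton (N : ℕ) (a : ℕ → S) :
    Preorder.frestrictLe (π := fun _ : ℕ => S) N ⁻¹' {Preorder.frestrictLe N a}
      = pathCylinder N a := by
  ext x
  simp [pathCylinder, funext_iff]

theorem preimage_frestrictLe_prod_singleton (N : ℕ) (a : ℕ → S) :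
    (fun x : ℕ → S => (Preorder.frestrictLe (π := fun _ : ℕ => S) N x, x (N + 1))) ⁻¹'
      ({Preorder.frestrictLe N a} ×ˢ {a (N + 1)}) = pathCylinder (N + 1) a := by
  ext x
  simp only [pathCylinder, Set.mem_preimage, Set.mem_prod, Set.mem_singleton_iff, funext_iff,
    Preorder.frestrictLe_apply, Subtype.forall, Finset.mem_Iic, Set.mem_ofPred_eq,
    ← Nat.lt_succ_iff, Nat.forall_lt_succ_right (n := N + 1)]

variable [MeasurableSpace S]

theorem measurable_pathShift : Measurable (pathShift : (ℕ → S) → ℕ → S) :=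
  measurable_pi_lambda _ fun _ => measurable_pi_apply _

variable [DiscreteMeasurableSpace S]

theorem measurableSet_startsAt (s : S) : MeasurableSet (startsAt s) :=
  measurable_pi_apply (X := fun _ : ℕ => S) 0 (measurableSet_singleton s)

theorem measurableSet_pathCylinder (N : ℕ) (a : ℕ → S) : MeasurableSet (pathCylinder N a) := by
  induction N generalizing a with
  | zero =>
    rw [pathCylinder_zero]
    exact measurableSet_startsAt _
  | succ N ih =>
    rw [pathCylinder_succ]
    exact (measurableSet_startsAt _).inter (measurable_pathShift (ih _))

variable [Countable S]

theorem measure_ext_of_pathCylinder {μ ν : Measure (ℕ → S)} [IsFiniteMeasure μ]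
    (h : ∀ N a, μ (pathCylinder N a) = ν (pathCylinder N a)) : μ = ν := by
  have hμ : ∀ N, μ.map (Preorder.frestrictLe (π := fun _ : ℕ => S) N)
      = ν.map (Preorder.frestrictLe N) := fun N => by
    refine Measure.ext_of_singleton fun b => ?_
    obtain ⟨a, rfl⟩ : ∃ a : ℕ → S, Preorder.frestrictLe N a = b :=
      ⟨fun k => b ⟨min k N, by simp⟩, funext fun k => by simp [Finset.mem_Iic.1 k.2]⟩
    rw [Measure.map_apply (by fun_prop) (measurableSet_singleton _),
      Measure.map_apply (by fun_prop) (measurableSet_singleton _),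
      preimage_frestrictLe_singleton, h]
  have hν : IsProjectiveLimit ν fun I => μ.map (I.restrict (π := fun _ : ℕ => S)) := fun I => by
    have hsub : I ⊆ Finset.Iic (I.sup id) := fun i hi =>
      Finset.mem_Iic.2 (Finset.le_sup (f := id) hi)
    have hcomp : I.restrict (π := fun _ : ℕ => S)
        = Finset.restrict₂ (π := fun _ : ℕ => S) hsub ∘ Preorder.frestrictLe (I.sup id) := rfl
    beta_reduce
    rw [hcomp, ← Measure.map_map (by fun_prop) (by fun_prop),
      ← Measure.map_map (by fun_prop) (by fun_prop), hμ]
  exact IsProjectiveLimit.unique (fun _ => rfl) hν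

end PathSpace

section ChainLaw

variable {S : Type*} [Countable S] [MeasurableSpace S] [DiscreteMeasurableSpace S]

/-- The transition kernel `K` as the sequence of kernels from histories to the next state that the
Ionescu-Tulcea theorem takes as input. -/
noncomputable def historyKernel (K : S → PMF S) (n : ℕ) :
    Kernel (Π _ : Finset.Iic n, S) S :=
  Kernel.ofFunOfCountable fun x => (K (x ⟨n, by simp⟩)).toMeasure

instance (K : S → PMF S) (n : ℕ) : IsMarkovKernel (historyKernel K n) :=
  ⟨fun x => inferInstanceAs (IsProbabilityMeasure (K (x ⟨n, by simp⟩)).toMeasure)⟩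

/-- The law on path space of the Markov chain with transition kernel `K` and initial
distribution `q`. -/
noncomputable def chainLaw (K : S → PMF S) (q : PMF S) : Measure (ℕ → S) :=
  Kernel.trajMeasure (X := fun _ => S) q.toMeasure (historyKernel K)

instance (K : S → PMF S) (q : PMF S) : IsProbabilityMeasure (chainLaw K q) :=
  inferInstanceAs (IsProbabilityMeasure
    (Kernel.trajMeasure (X := fun _ => S) q.toMeasure (historyKernel K)))

variable (K : S → PMF S) (q : PMF S)

theorem chainLaw_startsAt (s : S) : chainLaw K q (startsAt s) = q s := by
  have hmap : (chainLaw K q).map (Preorder.frestrictLe (π := fun _ : ℕ => S) 0)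
      = q.toMeasure.map (MeasurableEquiv.piUnique fun _ : Finset.Iic 0 => S).symm := by
    rw [chainLaw, Kernel.trajMeasure, Measure.map_comp _ _ (by fun_prop),
      Kernel.traj_map_frestrictLe, Kernel.partialTraj_self, Measure.id_comp]
  have hpre : (MeasurableEquiv.piUnique fun _ : Finset.Iic 0 => S).symm ⁻¹'
      {Preorder.frestrictLe 0 fun _ => s} = {s} :=
    Set.ext fun t => ⟨fun h => congrFun h default, by rintro rfl; rfl⟩
  rw [← pathCylinder_zero fun _ => s, ← preimage_frestrictLe_singleton,
    ← Measure.map_apply (by fun_prop) (measurableSet_singleton _), hmap,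
    Measure.map_apply (by fun_prop) (measurableSet_singleton _), hpre,
    PMF.toMeasure_apply_singleton _ _ (measurableSet_singleton _)]

theorem chainLaw_pathCylinder_succ (N : ℕ) (a : ℕ → S) :
    chainLaw K q (pathCylinder (N + 1) a)
      = chainLaw K q (pathCylinder N a) * K (a N) (a (N + 1)) := by
  have h := congrArg (fun m : Measure _ => m ({Preorder.frestrictLe N a} ×ˢ {a (N + 1)}))
    (Kernel.map_frestrictLe_trajMeasure_compProd_eq_map_trajMeasure (X := fun _ => S)
      (μ₀ := q.toMeasure) (κ := historyKernel K) (a := N))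
  beta_reduce at h
  rw [Measure.compProd_apply_prod (measurableSet_singleton _) (measurableSet_singleton _),
    Measure.map_apply (by fun_prop) (Set.to_countable _).measurableSet,
    Measure.restrict_singleton, lintegral_smul_measure, lintegral_dirac,
    Measure.map_apply (by fun_prop) (measurableSet_singleton _),
    preimage_frestrictLe_singleton, preimage_frestrictLe_prod_singleton] at h
  rw [← PMF.toMeasure_apply_singleton (K (a N)) _ (measurableSet_singleton _)]
  exact h.symm

variable {K q}

theorem eq_chainLaw {ν : Measure (ℕ → S)} (hinit : ∀ s, ν (startsAt s) = q s)
    (hstep : ∀ N a, ν (pathCylinder (N + 1) a) = ν (pathCylinder N a) * K (a N) (a (N + 1))) :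
    ν = chainLaw K q := by
  refine (measure_ext_of_pathCylinder fun N a => ?_).symm
  induction N with
  | zero => rw [pathCylinder_zero, chainLaw_startsAt, hinit]
  | succ N ih => rw [chainLaw_pathCylinder_succ, hstep, ih]

theorem chainLaw_pathCylinder (K : S → PMF S) (q : PMF S) (N : ℕ) (a : ℕ → S) :
    chainLaw K q (pathCylinder N a)
      = q (a 0) * ∏ k ∈ Finset.range N, K (a k) (a (k + 1)) := by
  induction N with
  | zero => rw [pathCylinder_zero, chainLaw_startsAt, Finset.prod_range_zero, mul_one]
  | succ N ih => rw [chainLaw_pathCylinder_succ, ih, Finset.prod_range_succ, mul_assoc]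

theorem chainLaw_apply (K : S → PMF S) (q : PMF S) {B : Set (ℕ → S)} (hB : MeasurableSet B) :
    chainLaw K q B = ∑' s, q s * chainLaw K (PMF.pure s) B := by
  have hsum : chainLaw K q = Measure.sum fun s => q s • chainLaw K (PMF.pure s) :=
    measure_ext_of_pathCylinder fun N a => by
      rw [Measure.sum_apply _ (measurableSet_pathCylinder N a), tsum_eq_single (a 0)]
      · simp [chainLaw_pathCylinder]
      · exact fun s hs => by simp [chainLaw_pathCylinder, PMF.pure_apply, hs.symm]
  rw [hsum, Measure.sum_apply _ hB]
  simp only [Measure.smul_apply, smul_eq_mul]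

theorem chainLaw_pure_startsAt_inter (K : S → PMF S) (s : S) (B : Set (ℕ → S)) :
    chainLaw K (PMF.pure s) (startsAt s ∩ B) = chainLaw K (PMF.pure s) B := by
  refine Measure.measure_inter_eq_of_ae ?_
  refine (mem_ae_iff_prob_eq_one (measurableSet_startsAt s)).2 ?_
  rw [chainLaw_startsAt, PMF.pure_apply_self]

theorem chainLaw_startsAt_inter (K : S → PMF S) (q : PMF S) (s : S) {B : Set (ℕ → S)}
    (hB : MeasurableSet B) :
    chainLaw K q (startsAt s ∩ B) = q s * chainLaw K (PMF.pure s) B := by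
  rw [chainLaw_apply K q ((measurableSet_startsAt s).inter hB), tsum_eq_single s,
    chainLaw_pure_startsAt_inter]
  intro t hts
  rw [measure_mono_null Set.inter_subset_left, mul_zero]
  simp [chainLaw_startsAt, PMF.pure_apply, hts.symm]

theorem map_pathShift_chainLaw (K : S → PMF S) (q : PMF S) :
    (chainLaw K q).map pathShift = chainLaw K (q.bind K) := by
  refine (measure_ext_of_pathCylinder fun N a => ?_).symm
  have hC := measurableSet_pathCylinder N a
  rw [Measure.map_apply measurable_pathShift hC, chainLaw_apply K q (measurable_pathShift hC),
    chainLaw_pathCylinder, PMF.bind_apply, ← ENNReal.tsum_mul_right]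
  refine tsum_congr fun s => ?_
  rw [← chainLaw_pure_startsAt_inter, startsAt_inter_preimage_pathShift, chainLaw_pathCylinder,
    Finset.prod_range_succ']
  simp only [pathCons, PMF.pure_apply_self]
  ring

theorem chainLaw_startsAt_inter_preimage_pathShift (K : S → PMF S) (q : PMF S) (s : S)
    {B : Set (ℕ → S)} (hB : MeasurableSet B) :
    chainLaw K q (startsAt s ∩ pathShift ⁻¹' B) = q s * chainLaw K (K s) B := by
  rw [chainLaw_startsAt_inter K q s (measurable_pathShift hB),
    ← Measure.map_apply measurable_pathShift hB, map_pathShift_chainLaw, PMF.pure_bind]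

theorem chainLaw_pathCylinder_inter_preimage_iterate (K : S → PMF S) (q : PMF S) (N : ℕ)
    (a : ℕ → S) {B : Set (ℕ → S)} (hB : MeasurableSet B) :
    chainLaw K q (pathCylinder N a ∩ pathShift^[N] ⁻¹' B)
      = chainLaw K q (pathCylinder N a) * chainLaw K (PMF.pure (a N)) B := by
  induction N generalizing q a with
  | zero =>
    rw [pathCylinder_zero, Function.iterate_zero, Set.preimage_id,
      chainLaw_startsAt_inter K q _ hB, chainLaw_startsAt]
  | succ N ih =>
    have hC := measurableSet_pathCylinder N (pathShift a)
    rw [pathCylinder_succ_inter_preimage_iterate, pathCylinder_succ,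
      chainLaw_startsAt_inter_preimage_pathShift K q _
        (hC.inter (measurable_pathShift.iterate N hB)),
      chainLaw_startsAt_inter_preimage_pathShift K q _ hC, ih, mul_assoc]
    rfl

theorem absolutelyContinuous_chainLaw {s : S} (hs : 0 < q s) :
    chainLaw K (PMF.pure s) ≪ chainLaw K q := by
  refine Measure.AbsolutelyContinuous.mk fun B hB hqB => ?_
  rw [chainLaw_apply K q hB, ENNReal.tsum_eq_zero] at hqB
  exact (mul_eq_zero.1 (hqB s)).resolve_left hs.ne'

theorem measurePreserving_pathShift (hq : q.bind K = q) :
    MeasurePreserving pathShift (chainLaw K q) (chainLaw K q) :=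
  ⟨measurable_pathShift, by rw [map_pathShift_chainLaw, hq]⟩

theorem isSuperharmonic_chainLaw (K : S → PMF S) {A : Set (ℕ → S)} (hA : MeasurableSet A)
    (hinv : pathShift ⁻¹' A = A) : IsSuperharmonic K fun s => chainLaw K (PMF.pure s) A := by
  intro s
  rw [← chainLaw_apply K (K s) hA, ← PMF.pure_bind s K, ← map_pathShift_chainLaw,
    Measure.map_apply measurable_pathShift hA, hinv]

theorem restrict_chainLaw (hq : q.bind K = q) (hirr : IsIrreducible K) {A : Set (ℕ → S)}
    (hA : MeasurableSet A) (hinv : pathShift ⁻¹' A = A) :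
    (chainLaw K q).restrict A = chainLaw K q A • chainLaw K q := by
  obtain ⟨s₀, -⟩ := q.support_nonempty
  have hconst : ∀ s, chainLaw K (PMF.pure s) A = chainLaw K (PMF.pure s₀) A := fun s =>
    (isSuperharmonic_chainLaw K hA hinv).eq hq hirr s s₀
  have hA₀ : chainLaw K q A = chainLaw K (PMF.pure s₀) A := by
    simp_rw [chainLaw_apply K q hA, hconst, tsum_pmf_mul_const]
  refine measure_ext_of_pathCylinder fun N a => ?_
  have hinvN : pathShift^[N] ⁻¹' A = A := by
    rw [Set.preimage_iterate_eq]
    exact Function.iterate_fixed hinv N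
  rw [Measure.restrict_apply (measurableSet_pathCylinder N a), Measure.smul_apply, smul_eq_mul,
    ← congrArg (pathCylinder N a ∩ ·) hinvN,
    chainLaw_pathCylinder_inter_preimage_iterate K q N a hA, hconst, hA₀, mul_comm]

theorem ergodic_pathShift (hq : q.bind K = q) (hirr : IsIrreducible K) :
    Ergodic pathShift (chainLaw K q) := by
  refine ⟨measurePreserving_pathShift hq, ⟨fun {A} hA hinv => ?_⟩⟩
  have hsq : chainLaw K q A * chainLaw K q A = chainLaw K q A := by
    simpa using (congrArg (fun m : Measure _ => m A) (restrict_chainLaw hq hirr hA hinv)).symm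
  rw [eventuallyConst_set']
  rcases eq_or_ne (chainLaw K q A) 0 with h0 | h0
  · exact Or.inl (ae_eq_empty.2 h0)
  · exact Or.inr <| ae_eq_univ.2 <| (prob_compl_eq_zero_iff hA).2 <|
      (ENNReal.mul_eq_left h0 (measure_ne_top _ A)).1 hsq

end ChainLaw

section StrongLaw

variable {S : Type*} {K : S → PMF S} {p : PMF S} {φ : S → ℝ}

theorem integrable_of_summable [Countable S] [MeasurableSpace S] [DiscreteMeasurableSpace S]
    (hφ : Summable fun s => φ s * (p s).toReal) : Integrable φ p.toMeasure := by
  have hterm : ∀ s, ‖φ s‖ₑ * p.toMeasure {s} = ENNReal.ofReal ‖φ s * (p s).toReal‖ := fun s => by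
    rw [PMF.toMeasure_apply_singleton _ _ (measurableSet_singleton s), ofReal_norm, enorm_mul,
      Real.enorm_of_nonneg ENNReal.toReal_nonneg, ENNReal.ofReal_toReal (p.apply_ne_top s)]
  refine ⟨(measurable_of_countable φ).aestronglyMeasurable, ?_⟩
  rw [hasFiniteIntegral_iff_enorm, lintegral_countable']
  simp_rw [hterm]
  exact hφ.norm.tsum_ofReal_lt_top

theorem measurePreserving_eval_zero [Countable S] [MeasurableSpace S] [DiscreteMeasurableSpace S]
    (K : S → PMF S) (q : PMF S) :
    MeasurePreserving (fun x : ℕ → S => x 0) (chainLaw K q) q.toMeasure := by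
  have hmeas : Measurable fun x : ℕ → S => x 0 := measurable_pi_apply 0
  refine ⟨hmeas, Measure.ext_of_singleton fun s => ?_⟩
  rw [Measure.map_apply hmeas (measurableSet_singleton s),
    PMF.toMeasure_apply_singleton _ _ (measurableSet_singleton s)]
  exact chainLaw_startsAt K q s

theorem ae_tendsto_chainLaw [Countable S] [MeasurableSpace S] [DiscreteMeasurableSpace S]
    (hp : p.bind K = p) (hirr : IsIrreducible K)
    (hφ : Summable fun s => φ s * (p s).toReal) :
    ∀ᵐ x ∂chainLaw K p, Tendsto (fun N : ℕ => (1 / (N : ℝ)) * ∑ k ∈ Finset.range N, φ (x k))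
      atTop (𝓝 (∑' s, φ s * (p s).toReal)) := by
  have heval := measurePreserving_eval_zero K p
  have hint := integrable_of_summable hφ
  have hmean : ∫ x, φ (x 0) ∂chainLaw K p = ∑' s, φ s * (p s).toReal := by
    rw [← integral_map (φ := fun x : ℕ → S => x 0) heval.aemeasurable
      (measurable_of_countable φ).aestronglyMeasurable, heval.map_eq, PMF.integral_eq_tsum _ _ hint]
    simp_rw [smul_eq_mul, mul_comm]
  filter_upwards [ae_tendsto_birkhoffAverage (ergodic_pathShift hp hirr)
    (heval.integrable_comp_of_integrable hint)] with x hx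
  rw [← hmean]
  simpa [birkhoffAverage, birkhoffSum, pathShift_iterate_apply_zero] using hx

theorem IsMarkovChain.measurable_path [Countable S] [MeasurableSpace S] {Ω : Type*}
    [MeasurableSpace Ω] {μ : Measure Ω} {x₀ : S} {X : ℕ → Ω → S} (hX : IsMarkovChain μ K x₀ X) :
    Measurable fun ω k => X k ω :=
  measurable_pi_lambda _ fun k => measurable_to_countable' fun s => hX.measurable k s

theorem IsMarkovChain.map_path [Countable S] [MeasurableSpace S] [DiscreteMeasurableSpace S]
    {Ω : Type*} [MeasurableSpace Ω] {μ : Measure Ω} [IsProbabilityMeasure μ] {x₀ : S}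
    {X : ℕ → Ω → S} (hX : IsMarkovChain μ K x₀ X) :
    μ.map (fun ω k => X k ω) = chainLaw K (PMF.pure x₀) := by
  refine eq_chainLaw (fun s => ?_) fun N a => ?_
  · rw [Measure.map_apply hX.measurable_path (measurableSet_startsAt s)]
    change μ {ω | X 0 ω = s} = _
    by_cases hs : s = x₀
    · rw [hs, PMF.pure_apply_self]
      exact (mem_ae_iff_prob_eq_one (hX.measurable 0 x₀)).1 hX.initial
    · rw [PMF.pure_apply_of_ne _ _ hs]
      exact measure_eq_zero_iff_ae_notMem.2 <| hX.initial.mono fun ω hω h => hs (h.symm.trans hω)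
  · simp only [Measure.map_apply hX.measurable_path (measurableSet_pathCylinder _ _)]
    exact hX.markov N a

theorem IsMarkovChain.ae_tendsto {Ω : Type*} [MeasurableSpace Ω] {μ : Measure Ω}
    [IsProbabilityMeasure μ] {x₀ : S} {X : ℕ → Ω → S} (hX : IsMarkovChain μ K x₀ X)
    (hp : p.bind K = p) (hirr : IsIrreducible K) (hφ : Summable fun s => φ s * (p s).toReal) :
    ∀ᵐ ω ∂μ, Tendsto (fun N : ℕ => (1 / (N : ℝ)) * ∑ k ∈ Finset.range N, φ (X k ω))
      atTop (𝓝 (∑' s, φ s * (p s).toReal)) := by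
  have : Countable S := hirr.countable hp
  let _ : MeasurableSpace S := ⊤
  have : DiscreteMeasurableSpace S := ⟨fun _ => trivial⟩
  have hac : μ.map (fun ω k => X k ω) ≪ chainLaw K p := by
    rw [hX.map_path]
    exact absolutelyContinuous_chainLaw (hirr.apply_pos hp x₀)
  exact ae_of_ae_map hX.measurable_path.aemeasurable
    (hac.ae_le (ae_tendsto_chainLaw hp hirr hφ))

theorem IsMarkovChain.ae_tendsto_indicator {Ω : Type*} [MeasurableSpace Ω] {μ : Measure Ω}
    [IsProbabilityMeasure μ] {x₀ : S} {X : ℕ → Ω → S} (hX : IsMarkovChain μ K x₀ X)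
    (hp : p.bind K = p) (hirr : IsIrreducible K) (s : S) :
    ∀ᵐ ω ∂μ, Tendsto (fun N : ℕ => (1 / (N : ℝ)) *
        ∑ k ∈ Finset.range N, Set.indicator {s} (fun _ => (1 : ℝ)) (X k ω))
      atTop (𝓝 (p s).toReal) := by
  have hzero : ∀ t, t ≠ s → Set.indicator {s} (fun _ => (1 : ℝ)) t * (p t).toReal = 0 :=
    fun t ht => by rw [Set.indicator_of_notMem (Set.mem_singleton_iff.not.2 ht), zero_mul]
  have hmean : HasSum (fun t => Set.indicator {s} (fun _ => (1 : ℝ)) t * (p t).toReal)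
      (p s).toReal := by
    simpa using hasSum_single s hzero
  simpa only [hmean.tsum_eq] using hX.ae_tendsto hp hirr hmean.summable

end StrongLaw

section Involution

variable {Ξ : Type*} {n : ℕ}

theorem flipMomentum_flipMomentum (i : Fin n) (θ : Fin n → ℤˣ) :
    flipMomentum i (flipMomentum i θ) = θ := by
  simp [flipMomentum]

theorem flipMomentum_apply_self (i : Fin n) (θ : Fin n → ℤˣ) : flipMomentum i θ i = -θ i :=
  Function.update_self i _ θ

theorem flipMomentum_ne (i : Fin n) (θ : Fin n → ℤˣ) : flipMomentum i θ ≠ θ := fun h =>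
  Int.units_ne_iff_eq_neg.2 (flipMomentum_apply_self i θ) (congrFun h i)

theorem involution_involutive (i : Fin n) :
    Function.Involutive (involution i : ExtState Ξ n → ExtState Ξ n) := fun x =>
  Prod.ext rfl (flipMomentum_flipMomentum i x.2)

end Involution

section SkewDetailedBalance

variable {S : Type*}

theorem mul_min_one_div {c : ℝ≥0∞} (hc : c ≠ ∞) (d : ℝ≥0∞) : c * min 1 (d / c) = min c d := by
  rcases eq_or_ne c 0 with rfl | h0
  · simp
  · rw [mul_min, mul_one, ENNReal.mul_div_cancel h0 hc]

theorem tsum_mul_eq_of_skew {K : S → PMF S} {m : S → ℝ≥0∞} {σ : S → S} (hσ : σ.Bijective) {y : S}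
    (hskew : ∀ x, m x * K x y = m y * K (σ y) (σ x)) : ∑' x, m x * K x y = m y := by
  have hsum : ∑' x, K (σ y) (σ x) = 1 :=
    ((Equiv.ofBijective σ hσ).tsum_eq (K (σ y))).trans (K (σ y)).tsum_coe
  rw [tsum_congr hskew, ENNReal.tsum_mul_left, hsum, mul_one]

end SkewDetailedBalance

section ExtPMF

variable {Ξ : Type*} {n : ℕ}

/-- The extended target `extTarget p` as a probability distribution. -/
noncomputable def extPMF (p : PMF Ξ) : PMF (ExtState Ξ n) :=
  ⟨fun x => p x.1 * (2 ^ n)⁻¹, by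
    have hθ : ∀ ξ, ∑' _ : Fin n → ℤˣ, p ξ * (2 ^ n : ℝ≥0∞)⁻¹ = p ξ := fun ξ => by
      rw [tsum_fintype, Finset.sum_const, nsmul_eq_mul, mul_left_comm]
      simp [ENNReal.mul_inv_cancel]
    refine ENNReal.summable.hasSum_iff.2 ?_
    rw [ENNReal.tsum_prod', tsum_congr hθ, p.tsum_coe]⟩

theorem extPMF_apply (p : PMF Ξ) (x : ExtState Ξ n) : extPMF p x = p x.1 * (2 ^ n)⁻¹ := rfl

theorem toReal_extPMF (p : PMF Ξ) (x : ExtState Ξ n) : (extPMF p x).toReal = extTarget p x := by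
  simp [extPMF_apply, extTarget, mul_comm]

end ExtPMF

namespace Flows

variable {Ξ : Type*} {n : ℕ} {Q : Ξ → PMF Ξ} (F : Flows Q n)

section Invariance

theorem weight_ne_top (ξ : Ξ) (i : Fin n) : F.weight ξ i ≠ ∞ :=
  ((ENNReal.sum_lt_top.1 (F.sum_weight ξ ▸ ENNReal.one_lt_top)) i (Finset.mem_univ i)).ne

/-- The flow of mass `ω_i(ξ) π̃(ξ) Q_i(x, y)` proposed from `x = (ξ, θ)` to `y`. -/
noncomputable def proposalFlow (p : PMF Ξ) (i : Fin n) (x y : ExtState Ξ n) : ℝ≥0∞ :=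
  F.weight x.1 i * p x.1 * F.proposal i x y

/-- The probability that `P_i` rejects its proposal from `x`. -/
noncomputable def rejection (p : PMF Ξ) (i : Fin n) (x : ExtState Ξ n) : ℝ≥0∞ :=
  ∑' x', F.proposal i x x' * (1 - min 1 (F.ratio p i x x'))

variable (p : PMF Ξ) (i : Fin n) (x y : ExtState Ξ n)

theorem proposalFlow_ne_top : F.proposalFlow p i x y ≠ ∞ :=
  ENNReal.mul_ne_top (ENNReal.mul_ne_top (F.weight_ne_top _ _) (p.apply_ne_top _))
    (PMF.apply_ne_top _ _)

theorem proposalFlow_mul_min_ratio :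
    F.proposalFlow p i x y * min 1 (F.ratio p i x y)
      = min (F.proposalFlow p i x y)
        (F.proposalFlow p i (involution i y) (involution i x)) :=
  mul_min_one_div (F.proposalFlow_ne_top p i x y) _

open Classical in
theorem stepKernel_apply :
    F.stepKernel p i x y = F.proposal i x y * min 1 (F.ratio p i x y)
      + if y = involution i x then F.rejection p i x else 0 := by
  have hcoin : ∀ x', ((coin (F.ratio p i x x')).map fun b => if b then x' else involution i x) y
      = (if y = x' then min 1 (F.ratio p i x x') else 0)
        + if y = involution i x then 1 - min 1 (F.ratio p i x x') else 0 := fun x' => by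
    rw [PMF.map_apply, tsum_fintype, Fintype.sum_bool]
    simp [coin]
  simp_rw [stepKernel, PMF.bind_apply, hcoin, mul_add, ENNReal.tsum_add, mul_ite, mul_zero]
  congr 1
  · exact (tsum_eq_single y fun x' hx' => if_neg hx'.symm).trans (if_pos rfl)
  · split_ifs
    · rfl
    · exact tsum_zero

theorem skew_detailed_balance :
    F.weight x.1 i * p x.1 * F.stepKernel p i x y
      = F.weight y.1 i * p y.1 * F.stepKernel p i (involution i y) (involution i x) := by
  classical
  have hS : ∀ z : ExtState Ξ n, involution i (involution i z) = z := involution_involutive i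
  have haccept : F.proposalFlow p i x y * min 1 (F.ratio p i x y)
      = F.proposalFlow p i (involution i y) (involution i x)
        * min 1 (F.ratio p i (involution i y) (involution i x)) := by
    rw [proposalFlow_mul_min_ratio, proposalFlow_mul_min_ratio, hS, hS, min_comm]
  have hreject : F.weight x.1 i * p x.1 * (if y = involution i x then F.rejection p i x else 0)
      = F.weight y.1 i * p y.1 * (if involution i x = involution i (involution i y)
        then F.rejection p i (involution i y) else 0) := by
    rw [hS]
    by_cases hy : y = involution i x
    · rw [if_pos hy, if_pos hy.symm, hy, hS]
      rfl
    · rw [if_neg hy, if_neg (Ne.symm hy), mul_zero, mul_zero]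
  rw [stepKernel_apply, stepKernel_apply, mul_add, mul_add, hreject, ← mul_assoc, ← mul_assoc]
  exact congrArg (· + _) haccept

theorem chainKernel_apply :
    F.chainKernel p x y = ∑ i, F.weight x.1 i * F.stepKernel p i x y := by
  rw [chainKernel, PMF.bind_apply, tsum_fintype]
  rfl

theorem tsum_extPMF_mul_weight_mul_stepKernel :
    ∑' x, extPMF p x * F.weight x.1 i * F.stepKernel p i x y = extPMF p y * F.weight y.1 i := by
  refine tsum_mul_eq_of_skew (m := fun x : ExtState Ξ n => extPMF p x * F.weight x.1 i)
    (involution_involutive i).bijective fun x => ?_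
  calc extPMF p x * F.weight x.1 i * F.stepKernel p i x y
      = (2 ^ n)⁻¹ * (F.weight x.1 i * p x.1 * F.stepKernel p i x y) := by
        rw [extPMF_apply]; ring
    _ = extPMF p y * F.weight y.1 i * F.stepKernel p i (involution i y) (involution i x) := by
        rw [skew_detailed_balance, extPMF_apply]; ring

theorem extPMF_bind_chainKernel : (extPMF p).bind (F.chainKernel p) = extPMF p := by
  ext y
  simp_rw [PMF.bind_apply, chainKernel_apply, Finset.mul_sum, ← mul_assoc]
  rw [Summable.tsum_finsetSum fun _ _ => ENNReal.summable]
  simp_rw [tsum_extPMF_mul_weight_mul_stepKernel, ← Finset.mul_sum]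
  rw [F.sum_weight, mul_one]

end Invariance

section Irreducibility

theorem nbhd_one (i : Fin n) (ξ : Ξ) : F.nbhd i 1 ξ = outNbhd (F.E i) ξ := if_pos rfl

theorem nbhd_neg_one (i : Fin n) (ξ : Ξ) :
    F.nbhd i (-1) ξ = outNbhd (reverseEdges (F.E i)) ξ := if_neg (by decide)

variable {F} {p : PMF Ξ} {i : Fin n} {s : ℤˣ} {ξ ξ' : Ξ} {θ : Fin n → ℤˣ} {x y z : ExtState Ξ n}

theorem mem_nbhd_neg (h : ξ' ∈ F.nbhd i s ξ) : ξ ∈ F.nbhd i (-s) ξ' := by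
  rcases Int.units_eq_one_or s with rfl | rfl
  · rw [nbhd_one] at h
    rwa [nbhd_neg_one]
  · rw [nbhd_neg_one] at h
    rwa [neg_neg, nbhd_one]

variable (F) in
theorem pos_iff_exists_mem_nbhd : 0 < Q ξ ξ' ↔ ∃ i s, ξ' ∈ F.nbhd i s ξ := by
  have hedge : 0 < Q ξ ξ' ↔ ∃ i, (ξ, ξ') ∈ F.E i ∪ reverseEdges (F.E i) := by
    rw [← Set.mem_iUnion, F.cover_edges]
    rfl
  rw [hedge]
  refine exists_congr fun i => ⟨?_, ?_⟩
  · rintro (h | h)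
    · exact ⟨1, by rwa [nbhd_one]⟩
    · exact ⟨-1, by rwa [nbhd_neg_one]⟩
  · rintro ⟨s, h⟩
    rcases Int.units_eq_one_or s with rfl | rfl
    · exact Or.inl (by rwa [nbhd_one] at h)
    · exact Or.inr (by rwa [nbhd_neg_one] at h)

theorem mem_support_of_mem_nbhd (h : ξ' ∈ F.nbhd i s ξ) : ξ' ∈ (Q ξ).support :=
  ((Q ξ).apply_pos_iff ξ').1 (F.pos_iff_exists_mem_nbhd.2 ⟨i, s, h⟩)

theorem active_of_mem_nbhd (h : ξ' ∈ F.nbhd i s ξ) : F.Active ξ i := by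
  have hpos : 0 < (Q ξ).toOuterMeasure (F.nbhd i s ξ) := by
    rw [pos_iff_ne_zero, Ne, PMF.toOuterMeasure_apply_eq_zero_iff]
    exact Set.not_disjoint_iff.2 ⟨ξ', mem_support_of_mem_nbhd h, h⟩
  rcases Int.units_eq_one_or s with rfl | rfl
  · exact hpos.trans_le le_self_add
  · exact hpos.trans_le le_add_self

variable (F) in
theorem exists_active (i : Fin n) : ∃ ξ, F.Active ξ i := by
  obtain ⟨⟨u, v⟩, huv⟩ := F.edge_nonempty i
  exact ⟨u, active_of_mem_nbhd (s := 1) (ξ' := v) (by rwa [nbhd_one])⟩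

theorem proposal_pos (h : ξ' ∈ F.nbhd i (θ i) ξ) : 0 < F.proposal i (ξ, θ) (ξ', θ) := by
  rw [proposal, dif_pos ⟨ξ', h⟩, PMF.apply_pos_iff, PMF.mem_support_map_iff]
  exact ⟨ξ', (PMF.mem_support_filter_iff _).2 ⟨h, mem_support_of_mem_nbhd h⟩, rfl⟩

theorem snd_eq_or_eq_involution_of_proposal_pos (h : 0 < F.proposal i x y) :
    y.2 = x.2 ∨ y = involution i x := by
  rw [PMF.apply_pos_iff, proposal] at h
  split_ifs at h
  · obtain ⟨ξ', -, rfl⟩ := (PMF.mem_support_map_iff _ _ _).1 h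
    exact Or.inl rfl
  · exact Or.inr ((PMF.mem_support_pure_iff _ _).1 h)

theorem snd_eq_or_eq_involution (h : 0 < F.stepKernel p i x y) :
    y.2 = x.2 ∨ y = involution i x := by
  classical
  by_cases hy : y = involution i x
  · exact Or.inr hy
  · rw [stepKernel_apply, if_neg hy, add_zero] at h
    exact snd_eq_or_eq_involution_of_proposal_pos (pos_of_mul_pos_left h zero_le)

theorem stepKernel_pos (hp : ∀ ξ, 0 < p ξ) (h : ξ' ∈ F.nbhd i (θ i) ξ) :
    0 < F.stepKernel p i (ξ, θ) (ξ', θ) := by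
  classical
  have hback : ξ ∈ F.nbhd i (flipMomentum i θ i) ξ' := by
    rw [flipMomentum_apply_self]
    exact mem_nbhd_neg h
  have hflow : 0 < F.proposalFlow p i (involution i (ξ', θ)) (involution i (ξ, θ)) :=
    ENNReal.mul_pos (mul_ne_zero (active_of_mem_nbhd hback).ne' (hp _).ne') (proposal_pos hback).ne'
  have hratio : 0 < F.ratio p i (ξ, θ) (ξ', θ) :=
    ENNReal.div_pos hflow.ne' (F.proposalFlow_ne_top p i _ _)
  rw [stepKernel_apply]
  exact (ENNReal.mul_pos (proposal_pos h).ne' (lt_min one_pos hratio).ne').trans_le le_self_add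

theorem chainKernel_pos (hi : F.Active x.1 i) (h : 0 < F.stepKernel p i x y) :
    0 < F.chainKernel p x y := by
  rw [chainKernel_apply]
  exact (ENNReal.mul_pos hi.ne' h.ne').trans_le
    (Finset.single_le_sum (f := fun j => F.weight x.1 j * F.stepKernel p j x y)
      (fun _ _ => zero_le) (Finset.mem_univ i))

theorem skew_pos (hp : ∀ ξ, 0 < p ξ) (hi : F.Active x.1 i) (h : 0 < F.stepKernel p i x y) :
    F.Active y.1 i ∧ 0 < F.stepKernel p i (involution i y) (involution i x) := by
  have hflow : F.weight x.1 i * p x.1 * F.stepKernel p i x y ≠ 0 :=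
    mul_ne_zero (mul_ne_zero hi.ne' (hp _).ne') h.ne'
  rw [skew_detailed_balance] at hflow
  exact ⟨pos_iff_ne_zero.2 (left_ne_zero_of_mul (left_ne_zero_of_mul hflow)),
    pos_iff_ne_zero.2 (right_ne_zero_of_mul hflow)⟩

/-- A path of `P_i` that keeps the momentum until it flips `i` at some state `w` can be retraced
backwards from `S_i w` by skew detailed balance, so the flip can be performed in place. -/
theorem accessible_involution_of_accessible (hp : ∀ ξ, 0 < p ξ) (hi : F.Active x.1 i)
    (hxz : Accessible (F.stepKernel p i) x z) (hz : z.2 = flipMomentum i x.2) :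
    Accessible (F.chainKernel p) x (involution i x) := by
  induction hxz using Relation.ReflTransGen.head_induction_on with
  | refl => exact absurd hz.symm (flipMomentum_ne i z.2)
  | @head x w hxw _ ih =>
    rcases snd_eq_or_eq_involution hxw with hw | rfl
    · obtain ⟨hiw, hback⟩ := skew_pos hp hi hxw
      have hretrace : Accessible (F.chainKernel p) w (involution i x) :=
        (ih hiw (hw ▸ hz)).tail (chainKernel_pos (x := involution i w) hiw hback)
      exact .head (chainKernel_pos hi hxw) hretrace
    · exact .single (chainKernel_pos hi hxw)

theorem accessible_flipMomentum_of_active (hp : ∀ ξ, 0 < p ξ) (hflip : F.Flippable p)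
    (hi : F.Active ξ i) (θ : Fin n → ℤˣ) :
    Accessible (F.chainKernel p) (ξ, θ) (ξ, flipMomentum i θ) := by
  obtain ⟨m, ξ', hm⟩ := hflip ξ θ i hi
  exact accessible_involution_of_accessible hp hi (accessible_iff.2 ⟨m, hm⟩) rfl

theorem accessible_of_proposal_pos (hp : ∀ ξ, 0 < p ξ) (hflip : F.Flippable p)
    (h : 0 < Q ξ ξ') (θ : Fin n → ℤˣ) : Accessible (F.chainKernel p) (ξ, θ) (ξ', θ) := by
  obtain ⟨i, s, hs⟩ := F.pos_iff_exists_mem_nbhd.1 h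
  have hi : F.Active ξ i := active_of_mem_nbhd hs
  have hi' : F.Active ξ' i := active_of_mem_nbhd (mem_nbhd_neg hs)
  by_cases hθ : θ i = s
  · exact .single (chainKernel_pos (x := (ξ, θ)) hi (stepKernel_pos hp (by rwa [hθ])))
  · have hs' : ξ' ∈ F.nbhd i (flipMomentum i θ i) ξ := by
      rwa [flipMomentum_apply_self, ← Int.units_ne_iff_eq_neg.1 (Ne.symm hθ)]
    have hmove : 0 < F.chainKernel p (ξ, flipMomentum i θ) (ξ', flipMomentum i θ) :=
      chainKernel_pos (x := (ξ, flipMomentum i θ)) hi (stepKernel_pos hp hs')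
    have hunflip := accessible_flipMomentum_of_active hp hflip hi' (flipMomentum i θ)
    rw [flipMomentum_flipMomentum] at hunflip
    exact ((accessible_flipMomentum_of_active hp hflip hi θ).tail hmove).trans hunflip

theorem accessible_position (hp : ∀ ξ, 0 < p ξ) (hQ : IsIrreducible Q) (hflip : F.Flippable p)
    (ξ ξ' : Ξ) (θ : Fin n → ℤˣ) : Accessible (F.chainKernel p) (ξ, θ) (ξ', θ) := by
  induction hQ.accessible ξ ξ' with
  | refl => exact .refl
  | tail _ hstep ih => exact ih.trans (accessible_of_proposal_pos hp hflip hstep θ)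

theorem accessible_flipMomentum (hp : ∀ ξ, 0 < p ξ) (hQ : IsIrreducible Q)
    (hflip : F.Flippable p) (i : Fin n) (ξ : Ξ) (θ : Fin n → ℤˣ) :
    Accessible (F.chainKernel p) (ξ, θ) (ξ, flipMomentum i θ) := by
  obtain ⟨u, hu⟩ := F.exists_active i
  exact ((accessible_position hp hQ hflip ξ u θ).trans
    (accessible_flipMomentum_of_active hp hflip hu θ)).trans (accessible_position hp hQ hflip u ξ _)

theorem accessible_momentum (hp : ∀ ξ, 0 < p ξ) (hQ : IsIrreducible Q) (hflip : F.Flippable p)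
    (ξ : Ξ) (θ θ' : Fin n → ℤˣ) : Accessible (F.chainKernel p) (ξ, θ) (ξ, θ') := by
  have hpartial : ∀ s : Finset (Fin n),
      Accessible (F.chainKernel p) (ξ, θ) (ξ, s.piecewise θ' θ) := fun s => by
    induction s using Finset.induction_on with
    | empty => rw [Finset.piecewise_empty]; exact .refl
    | insert j s _ ih =>
      rw [Finset.piecewise_insert]
      by_cases hj : θ' j = s.piecewise θ' θ j
      · rwa [hj, Function.update_eq_self]
      · rw [Int.units_ne_iff_eq_neg.1 hj]
        exact ih.trans (accessible_flipMomentum hp hQ hflip j ξ _)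
  simpa using hpartial Finset.univ

theorem isIrreducible_chainKernel (hp : ∀ ξ, 0 < p ξ) (hQ : IsIrreducible Q)
    (hflip : F.Flippable p) : IsIrreducible (F.chainKernel p) := fun x x' =>
  accessible_iff.1 ((accessible_position hp hQ hflip x.1 x'.1 x.2).trans
    (accessible_momentum hp hQ hflip x'.1 x.2 x'.2))

end Irreducibility

end Flows

end LiftedFlow

theorem theorem4p5 {Ξ : Type*} [Countable Ξ] {n : ℕ}
    (Q : Ξ → PMF Ξ) (p : PMF Ξ) (F : LiftedFlow.Flows Q n)
    (hadm : LiftedFlow.Admissible Q p) (hflip : F.Flippable p) :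
    LiftedFlow.IsIrreducible (F.chainKernel p) ∧
    ∀ {Ω : Type*} [MeasurableSpace Ω] (μ : MeasureTheory.Measure Ω)
      [MeasureTheory.IsProbabilityMeasure μ]
      (x₀ : LiftedFlow.ExtState Ξ n) (X : ℕ → Ω → LiftedFlow.ExtState Ξ n),
      LiftedFlow.IsMarkovChain μ (F.chainKernel p) x₀ X →
      (∀ x' : LiftedFlow.ExtState Ξ n, ∀ᵐ ω ∂μ,
        Filter.Tendsto
          (fun N : ℕ => (1 / (N : ℝ)) *
            ∑ k ∈ Finset.range N, Set.indicator {x'} (fun _ => (1 : ℝ)) (X k ω))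
          Filter.atTop (nhds (LiftedFlow.extTarget p x'))) ∧
      (∀ φ : LiftedFlow.ExtState Ξ n → ℝ,
        Summable (fun x => φ x * LiftedFlow.extTarget p x) →
        ∀ᵐ ω ∂μ, Filter.Tendsto
          (fun N : ℕ => (1 / (N : ℝ)) * ∑ k ∈ Finset.range N, φ (X k ω))
          Filter.atTop (nhds (∑' x, φ x * LiftedFlow.extTarget p x))) := by
  have hinv := F.extPMF_bind_chainKernel p
  have hirr := LiftedFlow.Flows.isIrreducible_chainKernel hadm.pos hadm.irreducible hflip
  refine ⟨hirr, fun μ _ x₀ X hX => ⟨fun x' => ?_, fun φ hφ => ?_⟩⟩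
  · rw [← LiftedFlow.toReal_extPMF]
    exact hX.ae_tendsto_indicator hinv hirr x'
  · simp_rw [← LiftedFlow.toReal_extPMF] at hφ ⊢
    exact hX.ae_tendsto hinv hirr hφ
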